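/- Let $\mathbb S=\{z\in\mathbb C:|z|=1\}$ and $\mathbb S_+=\{z\in\mathbb S:\operatorname{Re} z\ge 0\}$. For an abelian topological group $(G,\tau)$, let $\widehat{(G,\tau)}$ be the group of its continuous characters, i.e. continuous homomorphisms $\chi:G\to\mathbb S$, and let $G^\wedge$ denote this group endowed with the compact-open topology. The group $G$ is called reflexive if the canonical homomorphism $\alpha_G:G\to G^{\wedge\wedge}$, $\alpha_G(g)(\chi)=\chi(g)$, is a topological isomorphism. It has finite exponent if there is an integer $n\ge 1$ with $g^n=e$ for all $g\in G$, where $e$ is the neutral element. A set $A\subseteq G$ is quasi-convex in $(G,\tau)$ if for every $g\in G\setminus A$ there is $\chi\in\widehat{(G,\tau)}$ with $\chi(g)\notin\mathbb S_+$ and $\chi(A)\subseteq\mathbb S_+$. The group $(G,\tau)$ is locally quasi-convex if it has a neighborhood base at $e$ consisting of quasi-convex sets. Two topologies $\tau,\nu$ on $G$ are compatible if $\widehat{(G,\tau)}=\widehat{(G,\nu)}$. A locally quasi-convex abelian group $(G,\tau)$ is a Mackey group if every locally quasi-convex group topology $\nu$ on $G$ compatible with $\tau$ satisfies $\nu\subseteq\tau$.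 **Theorem 1.2.** Every reflexive abelian topological group $(G,\tau)$ of finite exponent is a Mackey group. That is, $(G,\tau)$ is locally quasi-convex, and every locally quasi-convex group topology on $G$ that is compatible with $\tau$ is coarser than (or equal to) $\tau$. -/

import Mathlib

namespace MackeyGroup

/-- The closed right half `{z : Re z ≥ 0}` of the unit circle group. -/
def circlePlus : Set Circle := {z | 0 ≤ (z : ℂ).re}

/-- The set of continuous characters of the abelian group `G` equipped with the topology `τ`. -/
def characters {G : Type*} [CommGroup G] (τ : TopologicalSpace G) : Set (G →* Circle) :=
  {χ | @Continuous G Circle τ inferInstance χ}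

/-- `A` is quasi-convex in `(G, τ)`: every point outside `A` is separated from `A` by a
continuous character mapping `A` into the right half of the circle. -/
def IsQuasiConvex {G : Type*} [CommGroup G] (τ : TopologicalSpace G) (A : Set G) : Prop :=
  ∀ g, g ∉ A → ∃ χ ∈ characters τ, χ g ∉ circlePlus ∧ ∀ a ∈ A, χ a ∈ circlePlus

/-- `(G, τ)` has a neighborhood base at the neutral element consisting of quasi-convex sets. -/
def IsLocallyQuasiConvex {G : Type*} [CommGroup G] (τ : TopologicalSpace G) : Prop :=
  ∀ U ∈ @nhds G τ 1, ∃ A ∈ @nhds G τ 1, IsQuasiConvex τ A ∧ A ⊆ U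

/-- Two topologies on an abelian group are compatible if they have the same continuous
characters. -/
def Compatible {G : Type*} [CommGroup G] (τ ν : TopologicalSpace G) : Prop :=
  characters τ = characters ν

/-- `(G, τ)` is a Mackey group: it is locally quasi-convex, and every compatible locally
quasi-convex group topology `ν` on `G` is coarser than `τ`. In Mathlib's order on topologies,
`τ ≤ ν` means that every `ν`-open set is `τ`-open, i.e. that `ν` is coarser than `τ`. -/
def IsMackeyGroup (G : Type*) [CommGroup G] [τ : TopologicalSpace G] : Prop :=
  IsLocallyQuasiConvex τ ∧
    ∀ ν : TopologicalSpace G, @IsTopologicalGroup G ν _ → IsLocallyQuasiConvex ν →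
      Compatible τ ν → τ ≤ ν

/-- Evaluation at `g`, as a continuous character of the dual group. The dual group carries the
compact-open topology. -/
noncomputable def evalAt {G : Type*} [CommGroup G] [TopologicalSpace G] (g : G) :
    PontryaginDual (PontryaginDual G) :=
  ({ toFun := fun χ => χ g
     map_one' := rfl
     map_mul' := fun _ _ => rfl
     continuous_toFun :=
      (ContinuousMonoidHom.instContinuousEvalConst (A := G) (B := Circle)).1 g } :
    PontryaginDual G →ₜ* Circle)

/-- The canonical homomorphism of `G` to its double dual, sending `g` to `χ ↦ χ g`. -/
noncomputable def canonicalHom (G : Type*) [CommGroup G] [TopologicalSpace G] :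
    G →* PontryaginDual (PontryaginDual G) where
  toFun := evalAt
  map_one' := PontryaginDual.ext fun χ => map_one χ
  map_mul' g h := PontryaginDual.ext fun χ => map_mul χ g h

/-- `G` is reflexive: the canonical homomorphism to the double dual is a topological
isomorphism. -/
def IsReflexive (G : Type*) [CommGroup G] [TopologicalSpace G] : Prop :=
  IsHomeomorph (canonicalHom G)

end MackeyGroup

/-!
Finite exponent forces locally quasi-convex topologies to be linear. Let `ν` be such a topology
compatible with `τ`. The half circle contains no nontrivial subgroup, so every neighborhood of the
neutral element for `ν` contains a `ν`-open subgroup `H`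
(`IsLocallyQuasiConvex.exists_isOpen_subgroup_subset`), and `τ ≤ ν` amounts to each such `H` being
`τ`-open.

Every character of the discrete group `G ⧸ H` is `ν`-continuous on `G`, hence `τ`-continuous. The
image in `G ⧸ H` of a `τ`-compact set is therefore compact for the Bohr topology, and so finite by a
theorem of Glicksberg (`finite_of_isCompact_of_forall_continuous`). It follows that on the annihilator
of `H`, the compact-open topology is the compact topology of the dual of `G ⧸ H`
(`isCompact_annihilator`). Continuity of the canonical homomorphism turns the polar of this compact
set, which is `H`, into a `τ`-neighborhood (`subgroup_mem_nhds_one`).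

That a reflexive group of finite exponent is itself locally quasi-convex is seen from polars of
compact sets of characters stable under powers (`IsReflexive.isLocallyQuasiConvex`).
-/

open Filter Set Topology

namespace MackeyGroup

/-! ### The right half of the circle -/

/-- The right half of the circle contains no nontrivial cyclic subgroup. By the double angle formula, a
power whose square also has nonnegative real part has positive real part. -/
theorem eq_one_of_forall_pow_mem_circlePlus {z : Circle} (hz : ∀ n : ℕ, z ^ n ∈ circlePlus) :
    z = 1 := by
  refine Circle.eq_one_of_forall_pow_mem_centeredArc_pi_div_two fun n _ => ?_
  rw [Circle.mem_centeredArc (by linarith [Real.pi_pos]), Complex.abs_arg_lt_pi_div_two_iff]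
  left
  set w := z ^ n with hw
  have h1 : 0 ≤ (w : ℂ).re := hz n
  have h2 : 0 ≤ ((w ^ 2 : Circle) : ℂ).re := by
    rw [hw, ← pow_mul]; exact hz _
  have h3 : (w : ℂ).re * (w : ℂ).re + (w : ℂ).im * (w : ℂ).im = 1 := by
    rw [← Complex.normSq_apply]; exact Circle.normSq_coe w
  rw [Circle.coe_pow, pow_two, Complex.mul_re] at h2
  nlinarith

theorem one_mem_circlePlus : (1 : Circle) ∈ circlePlus := by
  simp [circlePlus]

theorem circlePlus_mem_nhds_one : circlePlus ∈ 𝓝 (1 : Circle) := by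
  have h : IsOpen {z : Circle | 0 < (z : ℂ).re} :=
    isOpen_lt continuous_const (by fun_prop)
  exact mem_of_superset (h.mem_nhds (by simp)) fun z (hz : 0 < (z : ℂ).re) => hz.le

/-! ### Characters of abstract abelian groups -/

/-- Characters separate the points of an abelian group: a character to `ℚ / ℤ` is composed with the
embedding of `ℚ / ℤ` into `ℝ / ℤ`. -/
theorem exists_character_ne_one {Q : Type*} [CommGroup Q] {q : Q} (hq : q ≠ 1) :
    ∃ χ : Q →* Circle, χ q ≠ 1 := by
  obtain ⟨c, hc⟩ := CharacterModule.exists_character_apply_ne_zero_of_ne_zero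
    (A := Additive Q) (a := Additive.ofMul q) hq
  let cast : ℚ →+ ℝ := (Rat.castHom ℝ).toAddMonoidHom
  have hcast : AddSubgroup.zmultiples (1 : ℚ) ≤ (AddSubgroup.zmultiples (1 : ℝ)).comap cast := by
    rw [AddSubgroup.zmultiples_le]
    exact ⟨1, by simp [cast]⟩
  let j : AddCircle (1 : ℚ) →+ AddCircle (1 : ℝ) := QuotientAddGroup.map _ _ cast hcast
  have hj : ∀ x, j x = 0 → x = 0 := by
    intro x hx
    induction x using QuotientAddGroup.induction_on with
    | H x =>
      have hx' : ((cast x : ℝ) : AddCircle (1 : ℝ)) = 0 := hx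
      rw [AddCircle.coe_eq_zero_iff] at hx'
      obtain ⟨n, hn⟩ := hx'
      refine (AddCircle.coe_eq_zero_iff _).2 ⟨n, ?_⟩
      have : ((n : ℚ) : ℝ) = (x : ℝ) := by simpa [cast] using hn
      simpa using Rat.cast_injective this
  refine ⟨⟨⟨fun a => AddCircle.toCircle (j (c (Additive.ofMul a))), ?_⟩, ?_⟩, ?_⟩
  · simp
  · intro a b
    simp [AddCircle.toCircle_add]
  · intro h
    refine hc (hj _ (AddCircle.injective_toCircle one_ne_zero ?_))
    simpa using h

theorem exists_character_ne_one_of_notMem {Q : Type*} [CommGroup Q] {L : Subgroup Q} {q : Q}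
    (hq : q ∉ L) : ∃ χ : Q →* Circle, (∀ x ∈ L, χ x = 1) ∧ χ q ≠ 1 := by
  obtain ⟨χ, hχ⟩ := exists_character_ne_one (q := (q : Q ⧸ L))
    (by rwa [Ne, QuotientGroup.eq_one_iff])
  exact ⟨χ.comp (QuotientGroup.mk' L), fun x hx => by
    simp [(QuotientGroup.eq_one_iff x).2 hx], hχ⟩

/-! ### Bohr-compact sets in groups of finite exponent -/

theorem countable_closure_range {Q : Type*} [Group Q] (q : ℕ → Q) :
    Countable (Subgroup.closure (range q)) := by
  rw [← FreeGroup.range_lift_eq_closure]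
  have : Countable (FreeGroup ℕ) := inferInstanceAs (Countable (Quot _))
  exact (FreeGroup.lift q).rangeRestrict_surjective.countable

theorem finite_circle_pow_eq_one {N : ℕ} (hN : 0 < N) : {z : Circle | z ^ N = 1}.Finite := by
  refine Finite.of_finite_image (f := fun z : Circle => (z : ℂ)) ?_ Circle.coe_injective.injOn
  refine (Polynomial.nthRootsFinset N (1 : ℂ)).finite_toSet.subset ?_
  rintro _ ⟨z, hz, rfl⟩
  have hz : z ^ N = 1 := hz
  simp only [Finset.mem_coe, Polynomial.mem_nthRootsFinset hN]
  rw [← Circle.coe_pow, hz, Circle.coe_one]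

/-- In a group of finite exponent, a sequence on which every character tends to `1` takes only
finitely many values from some index on. On each character of the compact dual group the sequence is
eventually equal to `1`, so by the Baire category theorem some tail is annihilated by an open
subgroup of the dual. This subgroup has finite index, which leaves finitely many elements. -/
theorem exists_finite_image_Ici_of_tendsto {Q : Type*} [CommGroup Q] {N : ℕ} (hN : 0 < N)
    (hQ : ∀ q : Q, q ^ N = 1) {x : ℕ → Q}
    (hx : ∀ χ : Q →* Circle, Tendsto (fun n => χ (x n)) atTop (𝓝 1)) :
    ∃ m, (x '' Ici m).Finite := by
  let : TopologicalSpace Q := ⊥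
  have : DiscreteTopology Q := ⟨rfl⟩
  have heval : ∀ q : Q, Continuous fun χ : PontryaginDual Q => χ q := fun q =>
    (ContinuousMonoidHom.instContinuousEvalConst (A := Q) (B := Circle)).1 q
  let C : ℕ → Subgroup (PontryaginDual Q) := fun m =>
    { carrier := {χ | ∀ n ∈ Ici m, χ (x n) = 1}
      one_mem' := fun _ _ => rfl
      mul_mem' := fun {a b} ha hb n hn => by
        change a (x n) * b (x n) = 1
        rw [ha n hn, hb n hn, one_mul]
      inv_mem' := fun {a} ha n hn => by
        change (a (x n))⁻¹ = 1
        rw [ha n hn, inv_one] }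
  have hclosed : ∀ m, IsClosed (C m : Set (PontryaginDual Q)) := by
    intro m
    have : (C m : Set (PontryaginDual Q)) = ⋂ n ∈ Ici m, {χ | χ (x n) = 1} := by
      ext χ; simp [C]
    rw [this]
    exact isClosed_biInter fun n _ => isClosed_eq (heval _) continuous_const
  have hunion : ⋃ m, (C m : Set (PontryaginDual Q)) = univ := by
    refine eq_univ_of_forall fun χ => ?_
    -- The values are `N`-th roots of unity, among which `1` is isolated.
    have hopen : ({z : Circle | z ^ N = 1} \ {1})ᶜ ∈ 𝓝 (1 : Circle) :=
      ((finite_circle_pow_eq_one hN).subset sdiff_subset).isClosed.isOpen_compl.mem_nhds (by simp)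
    obtain ⟨m, hm⟩ := eventually_atTop.1 ((hx (χ : Q →* Circle)).eventually hopen)
    refine mem_iUnion.2 ⟨m, fun n hn => ?_⟩
    have h1 := hm n hn
    have h2 : χ (x n) ^ N = 1 := by rw [← map_pow, hQ, map_one]
    by_contra h3
    exact h1 ⟨h2, h3⟩
  obtain ⟨m, hm⟩ := nonempty_interior_of_iUnion_of_closed hclosed hunion
  have hCopen : IsOpen (C m : Set (PontryaginDual Q)) := by
    obtain ⟨χ, hχ⟩ := hm
    exact (C m).isOpen_of_mem_nhds (mem_interior_iff_mem_nhds.1 hχ)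
  have : Finite (PontryaginDual Q ⧸ C m) := (C m).quotient_finite_of_isOpen hCopen
  have : Finite {z : Circle | z ^ N = 1} := finite_circle_pow_eq_one hN
  -- On a tail element, a character depends only on its class modulo `C m`, so the tail elements are
  -- determined by their values on representatives of the finitely many classes.
  let Φ : Q → (PontryaginDual Q ⧸ C m) → {z : Circle | z ^ N = 1} := fun q c =>
    ⟨c.out q, by change _ ^ N = 1; rw [← map_pow, hQ, map_one]⟩
  refine ⟨m, Finite.of_finite_image (f := Φ) (toFinite _) ?_⟩
  rintro _ ⟨n, hn, rfl⟩ _ ⟨k, hk, rfl⟩ h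
  by_contra hne
  obtain ⟨χ, hχ⟩ := exists_character_ne_one (q := x n * (x k)⁻¹) (by rwa [Ne, mul_inv_eq_one])
  let ψ : PontryaginDual Q := (⟨χ, continuous_of_discreteTopology⟩ : Q →ₜ* Circle)
  have hmem : (QuotientGroup.mk ψ : PontryaginDual Q ⧸ C m).out⁻¹ * ψ ∈ C m :=
    QuotientGroup.eq.1 (Quotient.out_eq _)
  have hval : ∀ i ∈ Ici m, ψ (x i) = (QuotientGroup.mk ψ : PontryaginDual Q ⧸ C m).out (x i) := by
    intro i hi
    have := hmem i hi
    change (_)⁻¹ * ψ (x i) = 1 at this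
    exact (inv_mul_eq_one.1 this).symm
  apply hχ
  rw [map_mul, map_inv, mul_inv_eq_one]
  change ψ (x n) = ψ (x k)
  rw [hval n hn, hval k hk]
  exact congrArg Subtype.val (congrFun h _)

/-- **Glicksberg's theorem** for a discrete group of finite exponent: sets that are compact in the Bohr
topology, or in any finer one, are finite. Inside the subgroup generated by a sequence of distinct
elements, countably many characters separate points, so the compact set is metrizable there and the
sequence has a convergent subsequence. -/
theorem finite_of_isCompact_of_forall_continuous {Q : Type*} [CommGroup Q] [TopologicalSpace Q]
    (hexp : Monoid.ExponentExists Q) (hc : ∀ χ : Q →* Circle, Continuous χ) {K : Set Q}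
    (hK : IsCompact K) : K.Finite := by
  obtain ⟨N, hN, hQ⟩ := hexp
  by_contra hinf
  let e := Set.Infinite.natEmbedding K hinf
  let q : ℕ → Q := fun n => e n
  have hq : Function.Injective q := Subtype.val_injective.comp e.injective
  let L := Subgroup.closure (range q)
  have hqL : ∀ n, q n ∈ L := fun n => Subgroup.subset_closure (mem_range_self n)
  have : Countable L := countable_closure_range q
  -- `L` is an intersection of kernels, so limits of the sequence stay in `L`, where the countable
  -- family of characters chosen below separates points.
  have hLclosed : IsClosed (L : Set Q) := by
    have : (L : Set Q) = ⋂ χ ∈ {χ : Q →* Circle | ∀ y ∈ L, χ y = 1}, {y | χ y = 1} := by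
      ext y
      simp only [SetLike.mem_coe, mem_iInter, mem_ofPred_eq]
      refine ⟨fun hy χ hχ => hχ y hy, fun h => ?_⟩
      by_contra hy
      obtain ⟨χ, h1, h2⟩ := exists_character_ne_one_of_notMem hy
      exact h2 (h χ h1)
    rw [this]
    exact isClosed_biInter fun χ _ => isClosed_eq (hc χ) continuous_const
  let K' := K ∩ (L : Set Q)
  have hK' : IsCompact K' := hK.inter_right hLclosed
  have : CompactSpace K' := isCompact_iff_compactSpace.1 hK'
  have hsep : ∀ y : L, ∃ χ : Q →* Circle, y ≠ 1 → χ y ≠ 1 := by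
    intro y
    by_cases hy : y = 1
    · exact ⟨1, fun h => absurd hy h⟩
    · obtain ⟨χ, hχ⟩ := exists_character_ne_one (q := (y : Q)) (by simpa using hy)
      exact ⟨χ, fun _ => hχ⟩
  choose χ hχ using hsep
  let : Encodable L := Encodable.ofCountable L
  have : TopologicalSpace.MetrizableSpace K' := by
    refine Metric.PiNatEmbed.TopologicalSpace.MetrizableSpace.of_countable_separating (ι := L)
      (fun y (k : K') => χ y k) (fun y => (hc _).comp continuous_subtype_val) ?_
    rintro ⟨a, ha⟩ ⟨b, hb⟩ hab
    refine ⟨⟨a * b⁻¹, L.mul_mem ha.2 (L.inv_mem hb.2)⟩, fun h => ?_⟩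
    refine hχ ⟨a * b⁻¹, L.mul_mem ha.2 (L.inv_mem hb.2)⟩ ?_ ?_
    · intro h1
      exact hab (Subtype.ext (mul_inv_eq_one.1 (congrArg Subtype.val h1)))
    · change χ _ (a * b⁻¹) = 1
      rw [map_mul, map_inv, mul_inv_eq_one]
      exact h
  obtain ⟨k, φ, hφ, hlim⟩ := CompactSpace.tendsto_subseq
    (fun n => (⟨q n, (e n).2, hqL n⟩ : K'))
  obtain ⟨m, hm⟩ := exists_finite_image_Ici_of_tendsto hN hQ (x := fun n => q (φ n) * (k : Q)⁻¹) <| by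
    intro ψ
    have h := (((hc ψ).comp continuous_subtype_val).tendsto k).comp hlim
    have h' := h.mul_const (ψ k)⁻¹
    simpa [Function.comp_def] using h'
  refine (Ici_infinite m) (hm.of_finite_image ?_)
  intro a _ b _ hab
  exact hφ.injective (hq (mul_right_cancel hab))

/-! ### Locally quasi-convex groups of finite exponent -/

theorem eventually_forall_pow_mem {G : Type*} [CommGroup G] [TopologicalSpace G]
    [IsTopologicalGroup G] (hexp : Monoid.ExponentExists G) {A : Set G} (hA : A ∈ 𝓝 1) :
    ∀ᶠ g in 𝓝 (1 : G), ∀ n : ℕ, g ^ n ∈ A := by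
  obtain ⟨N, hN, hG⟩ := hexp
  have h : ∀ᶠ g in 𝓝 (1 : G), ∀ n ∈ Finset.range N, g ^ n ∈ A :=
    (eventually_all_finset _).2 fun n _ =>
      (continuous_pow n).continuousAt.eventually_mem (by simpa using hA)
  filter_upwards [h] with g hg n
  rw [pow_eq_pow_mod n (hG g)]
  exact hg _ (Finset.mem_range.2 (n.mod_lt hN))

/-- A locally quasi-convex group of finite exponent has arbitrarily small open subgroups. For a
quasi-convex neighborhood `A`, the subgroup is the common kernel of the characters in the polar of `A`;
it contains every `g` all of whose powers lie in `A`, and finite exponent makes these a neighborhood. -/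
theorem IsLocallyQuasiConvex.exists_isOpen_subgroup_subset {G : Type*} [CommGroup G]
    [TopologicalSpace G] [IsTopologicalGroup G] (hexp : Monoid.ExponentExists G)
    (hG : IsLocallyQuasiConvex (inferInstance : TopologicalSpace G)) {U : Set G} (hU : U ∈ 𝓝 1) :
    ∃ H : Subgroup G, IsOpen (H : Set G) ∧ (H : Set G) ⊆ U := by
  obtain ⟨A, hA, hqc, hAU⟩ := hG U hU
  let H : Subgroup G :=
    ⨅ χ ∈ {χ : G →* Circle | Continuous χ ∧ ∀ a ∈ A, χ a ∈ circlePlus}, χ.ker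
  have hmem : ∀ g, g ∈ H ↔
      ∀ χ : G →* Circle, Continuous χ → (∀ a ∈ A, χ a ∈ circlePlus) → χ g = 1 := by
    intro g
    simp [H, Subgroup.mem_iInf]
  refine ⟨H, H.isOpen_of_mem_nhds (g := 1) ?_, fun g hg => hAU ?_⟩
  · filter_upwards [eventually_forall_pow_mem hexp hA] with g hg
    refine (hmem g).2 fun χ _ hχ => eq_one_of_forall_pow_mem_circlePlus fun n => ?_
    rw [← map_pow]
    exact hχ _ (hg n)
  · by_contra hgA
    obtain ⟨χ, hχ, h1, h2⟩ := hqc g hgA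
    rw [(hmem g).1 hg χ hχ h2] at h1
    exact h1 one_mem_circlePlus

/-! ### Neighborhoods in reflexive groups -/

theorem pontryaginDual_pow_apply {G : Type*} [CommGroup G] [TopologicalSpace G]
    (χ : PontryaginDual G) (n : ℕ) (g : G) : (χ ^ n) g = χ g ^ n := by
  induction n with
  | zero => simp
  | succ n ih =>
    rw [pow_succ, pow_succ, ← ih]
    rfl

theorem continuous_of_isOpen_subgroup {G : Type*} [CommGroup G] [TopologicalSpace G]
    [IsTopologicalGroup G] {H : Subgroup G} (hH : IsOpen (H : Set G)) {χ : G →* Circle}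
    (hχ : ∀ h ∈ H, χ h = 1) : Continuous χ := by
  refine continuous_of_continuousAt_one χ (tendsto_nhds_of_eventually_eq ?_)
  rw [map_one]
  exact mem_of_superset (hH.mem_nhds H.one_mem) hχ

theorem le_of_nhds_one_le {G : Type*} [Group G] {τ ν : TopologicalSpace G}
    (hτ : @IsTopologicalGroup G τ _) (hν : @IsTopologicalGroup G ν _)
    (h : @nhds G τ 1 ≤ @nhds G ν 1) : τ ≤ ν := by
  refine le_of_nhds_le_nhds fun g => ?_
  have hτg := @map_mul_left_nhds_one G τ _ _ g
  have hνg := @map_mul_left_nhds_one G ν _ _ g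
  rw [← hτg, ← hνg]
  exact map_mono h

/-- If the canonical homomorphism is continuous, polars of compact sets of continuous
characters are neighborhoods of the neutral element. -/
theorem eventually_forall_mem_circlePlus {G : Type*} [CommGroup G] [TopologicalSpace G]
    (hG : Continuous (canonicalHom G)) {X : Set (PontryaginDual G)} (hX : IsCompact X) :
    ∀ᶠ g in 𝓝 (1 : G), ∀ χ ∈ X, χ g ∈ circlePlus := by
  have hopen : IsOpen {ξ : PontryaginDual (PontryaginDual G) |
      MapsTo ξ X (interior circlePlus)} :=
    (ContinuousMap.isOpen_setOfPred_mapsTo hX isOpen_interior).preimage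
      (ContinuousMonoidHom.isInducing_toContinuousMap (PontryaginDual G) Circle).continuous
  have h := (hopen.preimage hG).mem_nhds (x := 1) fun χ _ => by
    rw [map_one]
    exact mem_interior_iff_mem_nhds.2 circlePlus_mem_nhds_one
  filter_upwards [h] with g hg χ hχ
  exact interior_subset (hg hχ)

/-- Subbasic neighborhoods in the double dual come from compact sets `K` of characters. Enlarging `K`
to the compact set of all powers of its elements makes the polar contained in the annihilator of `K`. -/
theorem IsReflexive.isLocallyQuasiConvex {G : Type*} [CommGroup G] [TopologicalSpace G]
    (hG : IsReflexive G) (hexp : Monoid.ExponentExists G) :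
    IsLocallyQuasiConvex (inferInstance : TopologicalSpace G) := by
  obtain ⟨N, hN, hN1⟩ := hexp
  intro U hU
  have hind : IsInducing (ContinuousMonoidHom.toContinuousMap ∘ canonicalHom G) :=
    (ContinuousMonoidHom.isInducing_toContinuousMap (PontryaginDual G) Circle).comp hG.isInducing
  have hconst : (ContinuousMonoidHom.toContinuousMap ∘ canonicalHom G) 1 =
      ContinuousMap.const (PontryaginDual G) 1 := ContinuousMap.ext fun χ => map_one χ
  have hnhds := hind.nhds_eq_comap 1
  rw [hconst] at hnhds
  rw [hnhds] at hU
  obtain ⟨⟨K, V⟩, ⟨hK, hV⟩, hKV⟩ :=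
    ((𝓝 (1 : Circle)).basis_sets.nhds_continuousMapConst.comap _).mem_iff.1 hU
  let K' : Set (PontryaginDual G) := ⋃ n ∈ Finset.range N, (fun χ => χ ^ n) '' K
  have hK' : IsCompact K' :=
    (Finset.range N).isCompact_biUnion fun n _ => hK.image (continuous_pow n)
  have hpow : ∀ χ ∈ K, ∀ n : ℕ, χ ^ n ∈ K' := by
    intro χ hχ n
    have hχN : χ ^ N = 1 := PontryaginDual.ext fun g => by
      rw [pontryaginDual_pow_apply, ← map_pow, hN1, map_one, PontryaginDual.one_apply]
    rw [pow_eq_pow_mod n hχN]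
    exact mem_biUnion (Finset.mem_coe.2 (Finset.mem_range.2 (n.mod_lt hN))) (mem_image_of_mem _ hχ)
  refine ⟨{g | ∀ χ ∈ K', χ g ∈ circlePlus},
    eventually_forall_mem_circlePlus hG.continuous hK', fun g hg => ?_, fun g hg => hKV ?_⟩
  · simp only [mem_ofPred_eq, not_forall] at hg
    obtain ⟨χ, hχ, hg⟩ := hg
    exact ⟨(χ : G →* Circle), map_continuous χ, hg, fun a ha => ha χ hχ⟩
  · intro χ hχ
    have h1 : χ g = 1 := eq_one_of_forall_pow_mem_circlePlus fun n => by
      rw [← pontryaginDual_pow_apply]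
      exact hg _ (hpow χ hχ n)
    change χ g ∈ V
    rw [h1]
    exact mem_of_mem_nhds hV

/-- If all characters trivial on `H` are continuous, they form a compact set in the dual group of `G`.
It is the image of the compact dual of the discrete group `G ⧸ H`; pulling back along `G → G ⧸ H` is
continuous because compact subsets of `G` have finite image in `G ⧸ H`. -/
theorem isCompact_annihilator {G : Type*} [CommGroup G] [TopologicalSpace G]
    (hexp : Monoid.ExponentExists G) {H : Subgroup G}
    (hH : ∀ χ : G →* Circle, (∀ h ∈ H, χ h = 1) → Continuous χ) :
    IsCompact {χ : PontryaginDual G | ∀ h ∈ H, χ h = 1} := by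
  have hcomp : ∀ ψ : G ⧸ H →* Circle, Continuous (ψ.comp (QuotientGroup.mk' H)) := fun ψ =>
    hH _ fun h hh => by simp [(QuotientGroup.eq_one_iff h).2 hh]
  have hfin : ∀ K : Set G, IsCompact K → ((QuotientGroup.mk : G → G ⧸ H) '' K).Finite := by
    intro K hK
    have hexpQ : Monoid.ExponentExists (G ⧸ H) := by
      obtain ⟨N, hN, hN1⟩ := hexp
      refine ⟨N, hN, fun q => ?_⟩
      induction q using QuotientGroup.induction_on with
      | H g => rw [← QuotientGroup.mk_pow, hN1, QuotientGroup.mk_one]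
    exact finite_of_isCompact_of_forall_continuous hexpQ
      (fun ψ => isQuotientMap_quotient_mk'.continuous_iff.2 (hcomp ψ))
      (hK.image continuous_quotient_mk')
  let : TopologicalSpace (G ⧸ H) := ⊥
  have : DiscreteTopology (G ⧸ H) := ⟨rfl⟩
  let r : PontryaginDual (G ⧸ H) → PontryaginDual G := fun ψ =>
    (⟨(ψ : G ⧸ H →* Circle).comp (QuotientGroup.mk' H), hcomp ψ⟩ : G →ₜ* Circle)
  have hr : Continuous r := by
    refine (ContinuousMonoidHom.isInducing_toContinuousMap G Circle).continuous_iff.2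
      (ContinuousMap.continuous_compactOpen.2 fun K hK U hU => ?_)
    have hopen : IsOpen {ψ : PontryaginDual (G ⧸ H) |
        MapsTo ψ ((QuotientGroup.mk : G → G ⧸ H) '' K) U} :=
      (ContinuousMap.isOpen_setOfPred_mapsTo (hfin K hK).isCompact hU).preimage
        (ContinuousMonoidHom.isInducing_toContinuousMap (G ⧸ H) Circle).continuous
    convert hopen using 1
    ext ψ
    exact (mapsTo_image_iff (f := ψ) (g := (QuotientGroup.mk : G → G ⧸ H))).symm
  convert isCompact_range hr using 1
  ext χ
  constructor
  · intro hχ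
    exact ⟨(⟨QuotientGroup.lift H (χ : G →* Circle) hχ, continuous_of_discreteTopology⟩ :
      G ⧸ H →ₜ* Circle), rfl⟩
  · rintro ⟨ψ, rfl⟩ h hh
    change ψ (h : G ⧸ H) = 1
    rw [(QuotientGroup.eq_one_iff h).2 hh, map_one]

/-- A subgroup `H` all of whose annihilating characters are continuous is a neighborhood of the
neutral element: it is the polar of its compact annihilator. -/
theorem subgroup_mem_nhds_one {G : Type*} [CommGroup G] [TopologicalSpace G]
    (hG : Continuous (canonicalHom G)) (hexp : Monoid.ExponentExists G) {H : Subgroup G}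
    (hH : ∀ χ : G →* Circle, (∀ h ∈ H, χ h = 1) → Continuous χ) : (H : Set G) ∈ 𝓝 1 := by
  filter_upwards [eventually_forall_mem_circlePlus hG
    (isCompact_annihilator hexp hH)] with g hg
  by_contra hgH
  obtain ⟨χ, hχH, hχ⟩ := exists_character_ne_one_of_notMem hgH
  let χ' : PontryaginDual G := (⟨χ, hH χ hχH⟩ : G →ₜ* Circle)
  refine hχ (eq_one_of_forall_pow_mem_circlePlus fun n => ?_)
  have hn := hg (χ' ^ n) fun h hh => by
    rw [pontryaginDual_pow_apply, show χ' h = 1 from hχH h hh, one_pow]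
  rwa [pontryaginDual_pow_apply] at hn

end MackeyGroup

theorem theorem1p2 (G : Type*) [CommGroup G] [TopologicalSpace G] [IsTopologicalGroup G]
    (hrefl : MackeyGroup.IsReflexive G) (hexp : Monoid.ExponentExists G) :
    MackeyGroup.IsMackeyGroup G := by
  -- Stated before `ν` is introduced, so that `𝓝` refers to the given topology.
  have hnhds : ∀ H : Subgroup G, (∀ χ : G →* Circle, (∀ h ∈ H, χ h = 1) → Continuous χ) →
      (H : Set G) ∈ 𝓝 1 := fun H => MackeyGroup.subgroup_mem_nhds_one hrefl.continuous hexp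
  refine ⟨hrefl.isLocallyQuasiConvex hexp, fun ν hν hqc hcompat => ?_⟩
  refine MackeyGroup.le_of_nhds_one_le inferInstance hν fun U hU => ?_
  obtain ⟨H, hopen, hHU⟩ :=
    @MackeyGroup.IsLocallyQuasiConvex.exists_isOpen_subgroup_subset G _ ν hν hexp hqc U hU
  refine mem_of_superset (hnhds H fun χ hχ => ?_) hHU
  have hχν : χ ∈ MackeyGroup.characters ν :=
    @MackeyGroup.continuous_of_isOpen_subgroup G _ ν hν H hopen χ hχ
  rw [← hcompat] at hχν
  exact hχν
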